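/- Let $L$ be a countable one-sorted first-order language and let $T$ be a complete $L$-theory. Suppose that $T$ is almost indiscernible, i.e. $T$ has a model $M$ of cardinality $\aleph_1$ such that (a) $M$ is saturated: for every $A\subseteq M$ with $|A|<|M|$, every complete $n$-type over $A$ ($n\in\mathbb N$) is realized in $M$; and (b) there are $k\in\mathbb N$ and an indiscernible set $I\subseteq M^k$ (for every $n$, any two $n$-tuples of pairwise distinct members of $I$ satisfy the same $L$-formulas in $M$) such that $M=\operatorname{acl}(I)$, i.e. every element of $M$ lies in a finite subset of $M$ definable by an $L$-formula with parameters among the coordinates of the members of $I$. Then $T$ is $\omega$-stable: for every model $N$ of $T$, every countable $A\subseteq N$ and every $n\in\mathbb N$, there are only countably many complete $n$-types over $A$. -/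

import Mathlib

universe u v w w'

open FirstOrder Cardinal

namespace FirstOrder.Language

/-- The algebraic closure of a set `B` in an `L`-structure `M`: the union of all finite subsets of
`M` that are definable by an `L`-formula with parameters from `B`. -/
def acl (L : Language.{u, v}) {M : Type w} [L.Structure M] (B : Set M) : Set M :=
  {a | ∃ s : Set M, B.Definable₁ L s ∧ s.Finite ∧ a ∈ s}

/-- A set `I` of `k`-tuples of `M` is an indiscernible set (over `∅`) if, for every `n`, any two
`n`-tuples of pairwise distinct members of `I` satisfy the same `L`-formulas in `M`. -/
def IsIndiscernibleSet (L : Language.{u, v}) {M : Type w} [L.Structure M] {k : ℕ}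
    (I : Set (Fin k → M)) : Prop :=
  ∀ (n : ℕ) (e f : Fin n → (Fin k → M)),
    Function.Injective e → Function.Injective f → (∀ i, e i ∈ I) → (∀ i, f i ∈ I) →
    ∀ φ : L.Formula (Fin n × Fin k),
      φ.Realize (fun p => e p.1 p.2) ↔ φ.Realize (fun p => f p.1 p.2)

/-- The space `Sₙ(A)` of complete `n`-types over a set `A` of parameters from `M`, i.e. the
complete `n`-types of the theory of `M` with names for the elements of `A`. -/
abbrev TypesOver (L : Language.{u, v}) {M : Type w} [L.Structure M] (A : Set M) (n : ℕ) :=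
  (L[[A]].completeTheory M).CompleteType (Fin n)

/-- `M` is saturated if for every `A ⊆ M` with `|A| < |M|` all complete finitary types over `A`
are realized in `M`. -/
def IsSaturated (L : Language.{u, v}) (M : Type w) [L.Structure M] [Nonempty M] : Prop :=
  ∀ A : Set M, #A < #M → ∀ (n : ℕ) (p : L.TypesOver A n),
    p ∈ (L[[A]].completeTheory M).realizedTypes M (Fin n)

namespace Theory

/-- `T` has a saturated model of cardinality `ℵ₁` which is contained in the algebraic closure of
(the set of coordinates of) an indiscernible set of finite tuples. All members of an indiscernible
set have the same length `k`. -/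
def IsAlmostIndiscernible {L : Language.{u, v}} (T : L.Theory) : Prop :=
  ∃ M : ModelType.{u, v, w} T, #M = ℵ₁ ∧ L.IsSaturated M ∧
    ∃ (k : ℕ) (I : Set (Fin k → M)), L.IsIndiscernibleSet I ∧
      ∀ a : M, a ∈ L.acl (⋃ e ∈ I, Set.range e)

/-- `T` is `ω`-stable: over every countable set of parameters in a model of `T` there are only
countably many complete `n`-types, for every `n`. -/
def IsOmegaStable {L : Language.{u, v}} (T : L.Theory) : Prop :=
  ∀ (N : ModelType.{u, v, w} T) (A : Set N), A.Countable → ∀ n : ℕ, Countable (L.TypesOver A n)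

end Theory

end FirstOrder.Language

/-! ### Algebraic closure and its formulas. -/

namespace FirstOrder.Language

variable {L : Language.{u, v}} {M : Type w} [L.Structure M]

/-! By saturation, a countable `A ⊆ N` has a copy `g` in `M` with the same type, and every type over
`A` becomes the type over `g` of some tuple `b` of `M`. It remains to count types of tuples over `g`
(`exists_countable_invariant`).

The indiscernible set `I` is uncountable, since `acl` of a countable set is countable. Choose a
countable `J ⊆ I` with `g` inside `acl J`. Each `b` is algebraic over `J` and finitely many further
members `e` of `I`. By `realize_acl_iff`, the type of `e` over `acl J` depends only on its length.
As `b` is algebraic, its type over `J`, `g` and `e` is isolated by one formula. Hence the length of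
`e` and the isolating formula determine the type of `b` over `g`, and there are countably many such
pairs. -/

theorem Formula.exists_restrict_finset {α : Type*} (φ : L.Formula α) :
    ∃ (s : Finset α) (ψ : L.Formula s), ∀ {N : Type w} [L.Structure N] (x : α → N),
      ψ.Realize (fun i => x i) ↔ φ.Realize x := by
  classical
  exact ⟨φ.freeVarFinset, φ.restrictFreeVar id, fun x =>
    BoundedFormula.realize_restrictFreeVar x (fun _ => rfl)⟩

theorem acl_mono {A B : Set M} (h : A ⊆ B) : L.acl A ⊆ L.acl B := by
  rintro a ⟨s, hs, hf, ha⟩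
  exact ⟨s, Set.Definable.mono hs h, hf, ha⟩

theorem subset_acl (A : Set M) : A ⊆ L.acl A := fun a ha =>
  ⟨{a}, Set.Definable.singleton_of_mem L ha, Set.finite_singleton a, rfl⟩

theorem exists_finset_of_mem_acl {A : Set M} {a : M} (h : a ∈ L.acl A) :
    ∃ B : Finset M, (B : Set M) ⊆ A ∧ a ∈ L.acl (B : Set M) := by
  obtain ⟨s, hs, hf, ha⟩ := h
  obtain ⟨B, hB, hd⟩ := Set.definable_iff_finitely_definable.1 hs
  exact ⟨B, hB, s, hd, hf, ha⟩

theorem exists_finite_of_mem_acl_biUnion {κ : Type*} {I : Set κ} {R : κ → Set M} {a : M}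
    (h : a ∈ L.acl (⋃ e ∈ I, R e)) :
    ∃ F : Set κ, F ⊆ I ∧ F.Finite ∧ a ∈ L.acl (⋃ e ∈ F, R e) := by
  obtain ⟨B, hB, ha⟩ := exists_finset_of_mem_acl h
  have : ∀ b : B, ∃ e ∈ I, (b : M) ∈ R e := fun b => by simpa using hB b.2
  choose f hf using this
  refine ⟨Set.range f, ?_, Set.finite_range f, acl_mono ?_ ha⟩
  · rintro _ ⟨b, rfl⟩
    exact (hf b).1
  · intro b hb
    exact Set.mem_biUnion (Set.mem_range_self ⟨b, hb⟩) (hf ⟨b, hb⟩).2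

theorem exists_formula_of_mem_acl {δ : Type*} {d : δ → M} {a : M}
    (h : a ∈ L.acl (Set.range d)) :
    ∃ θ : L.Formula (δ ⊕ Fin 1), θ.Realize (Sum.elim d fun _ => a) ∧
      {x : Fin 1 → M | θ.Realize (Sum.elim d x)}.Finite := by
  obtain ⟨s, hs, hf, ha⟩ := h
  obtain ⟨φ, hφ⟩ := Set.definable_iff_exists_formula_sum.1 hs
  choose f hf' using fun x : Set.range d => x.2
  have key : ∀ x : Fin 1 → M, (φ.relabel (Sum.map f id)).Realize (Sum.elim d x) ↔ x 0 ∈ s := by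
    intro x
    rw [Formula.realize_relabel]
    have h1 : Sum.elim d x ∘ Sum.map f id = Sum.elim (↑) x := by
      ext (y | y)
      · exact hf' y
      · rfl
    rw [h1]
    have := Set.ext_iff.1 hφ x
    exact this.symm
  refine ⟨φ.relabel (Sum.map f id), (key _).2 ha, ?_⟩
  have h2 : {x : Fin 1 → M | (φ.relabel (Sum.map f id)).Realize (Sum.elim d x)} =
      (fun x : Fin 1 → M => x 0) ⁻¹' s := Set.ext key
  rw [h2]
  refine hf.preimage (Function.Injective.injOn ?_)
  intro x y hxy
  ext i
  rw [Subsingleton.elim i 0]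
  exact hxy

theorem exists_formula_of_forall_mem_acl {δ : Type*} {γ : Type*} [Finite γ] {d : δ → M}
    {c : γ → M} (h : ∀ i, c i ∈ L.acl (Set.range d)) :
    ∃ θ : L.Formula (δ ⊕ γ), θ.Realize (Sum.elim d c) ∧
      {x : γ → M | θ.Realize (Sum.elim d x)}.Finite := by
  choose θ hθ hfin using fun i => exists_formula_of_mem_acl (h i)
  have key : ∀ x : γ → M,
      (Formula.iInf fun i => (θ i).relabel (Sum.map id fun _ => i)).Realize (Sum.elim d x) ↔
        ∀ i, (θ i).Realize (Sum.elim d fun _ => x i) := by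
    intro x
    rw [Formula.realize_iInf]
    refine forall_congr' fun i => ?_
    rw [Formula.realize_relabel, Sum.elim_comp_map]
    rfl
  refine ⟨_, (key c).2 hθ, ?_⟩
  refine (Set.Finite.pi' fun i => (hfin i).image fun x : Fin 1 → M => x 0).subset ?_
  intro x hx i
  exact ⟨fun _ => x i, (key x).1 hx i, rfl⟩

/-- There are countably many formulas over `A`, and each algebraic one contributes finitely many
elements. -/
theorem countable_acl [Countable L.Symbols] {A : Set M} (hA : A.Countable) :
    (L.acl A).Countable := by
  have : Countable A := hA
  let S : L.Formula (A ⊕ Fin 1) → Set (Fin 1 → M) :=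
    fun θ => {x | θ.Realize (Sum.elim (fun a : A => (a : M)) x)}
  have hc : (⋃ θ ∈ {θ | (S θ).Finite}, (fun x : Fin 1 → M => x 0) '' S θ).Countable :=
    (Set.to_countable _).biUnion fun θ hθ => (Set.Finite.image _ hθ).countable
  refine hc.mono fun a ha => ?_
  have ha' : a ∈ L.acl (Set.range fun a : A => (a : M)) := by simpa using ha
  obtain ⟨θ, h1, h2⟩ := exists_formula_of_mem_acl ha'
  exact Set.mem_biUnion (x := θ) h2 ⟨_, h1, rfl⟩

/-- A tuple algebraic over `d` has its type over `d` isolated by a single formula: one with the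
least possible number of solutions. -/
theorem exists_isolating_formula_of_forall_mem_acl {δ : Type*} {γ : Type*} [Finite γ] {d : δ → M}
    {b : γ → M} (h : ∀ i, b i ∈ L.acl (Set.range d)) :
    ∃ χ : L.Formula (δ ⊕ γ), χ.Realize (Sum.elim d b) ∧
      ∀ φ : L.Formula (δ ⊕ γ), φ.Realize (Sum.elim d b) →
        ∀ x : γ → M, χ.Realize (Sum.elim d x) → φ.Realize (Sum.elim d x) := by
  let S : L.Formula (δ ⊕ γ) → Set (γ → M) := fun θ => {x | θ.Realize (Sum.elim d x)}
  let C : Set (L.Formula (δ ⊕ γ)) := {θ | b ∈ S θ ∧ (S θ).Finite}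
  have hC : C.Nonempty := exists_formula_of_forall_mem_acl h
  let χ := Function.argminOn (fun θ => (S θ).ncard) C hC
  have hχ : χ ∈ C := Function.argminOn_mem _ _ _
  refine ⟨χ, hχ.1, fun φ hφ x hx => ?_⟩
  have hsub : S (χ ⊓ φ) ⊆ S χ := fun y hy => (Formula.realize_inf.1 hy).1
  -- The conjunction competes for the minimum, so it cannot lose any solution of `χ`.
  have hmem : χ ⊓ φ ∈ C := ⟨Formula.realize_inf.2 ⟨hχ.1, hφ⟩, hχ.2.subset hsub⟩
  have hle : (S χ).ncard ≤ (S (χ ⊓ φ)).ncard :=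
    Function.argminOn_le (fun θ => (S θ).ncard) C hmem
  have heq := Set.eq_of_subset_of_ncard_le hsub hle hχ.2
  have : x ∈ S (χ ⊓ φ) := heq ▸ hx
  exact (Formula.realize_inf.1 this).2

end FirstOrder.Language

/-! ### Indiscernibility over algebraic closures, and counting types. -/

namespace FirstOrder.Language

variable {L : Language.{u, v}} {M : Type w} [L.Structure M]

theorem range_uncurry_subtype {κ X : Type*} (J : Set (κ → X)) :
    Set.range (fun p : J × κ => p.1.1 p.2) = ⋃ e ∈ J, Set.range e := by
  ext x
  simp

namespace IsIndiscernibleSet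

variable {k : ℕ} {I : Set (Fin k → M)}

theorem realize_iff (hI : L.IsIndiscernibleSet I) {α : Type*} {e f : α → (Fin k → M)}
    (he : Function.Injective e) (hf : Function.Injective f) (heI : ∀ i, e i ∈ I)
    (hfI : ∀ i, f i ∈ I) (φ : L.Formula (α × Fin k)) :
    φ.Realize (fun p => e p.1 p.2) ↔ φ.Realize (fun p => f p.1 p.2) := by
  classical
  obtain ⟨s, ψ, hψ⟩ := φ.exists_restrict_finset
  let t : Finset α := s.image Prod.fst
  let g : s → Fin t.card × Fin k := fun p =>
    (t.equivFin ⟨p.1.1, Finset.mem_image_of_mem _ p.2⟩, p.1.2)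
  have key : ∀ x : α → (Fin k → M), (ψ.relabel g).Realize
      (fun p => x (t.equivFin.symm p.1) p.2) ↔ φ.Realize (fun p => x p.1 p.2) := by
    intro x
    rw [Formula.realize_relabel, ← hψ]
    simp [g, Function.comp_def]
  rw [← key e, ← key f]
  have hinj : Function.Injective fun i => ((t.equivFin.symm i : t) : α) :=
    Subtype.val_injective.comp t.equivFin.symm.injective
  exact hI _ (fun i => e (t.equivFin.symm i)) (fun i => f (t.equivFin.symm i))
    (he.comp hinj) (hf.comp hinj) (fun _ => heI _) (fun _ => hfI _) _

variable {J : Set (Fin k → M)}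

/-- A formula `θ` over `J` confines `c` to a finite set. Among infinitely many disjoint tuples from
`I \ J`, two must cut out the same part of that set by `φ`. Such agreement is a property over `J`
alone, so indiscernibility spreads it to all disjoint pairs; a tuple disjoint from both `e` and `e'`
then links them. -/
theorem realize_acl_iff_of_finite (hI : L.IsIndiscernibleSet I) (hJ : J ⊆ I)
    (hinf : (I \ J).Infinite) {γ : Type*} [Finite γ] {c : γ → M}
    (hc : ∀ i, c i ∈ L.acl (⋃ e ∈ J, Set.range e)) {m : ℕ} {e e' : Fin m → (Fin k → M)}
    (he : Function.Injective e) (he' : Function.Injective e')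
    (heI : ∀ i, e i ∈ I \ J) (heI' : ∀ i, e' i ∈ I \ J) (φ : L.Formula (γ ⊕ Fin m × Fin k)) :
    φ.Realize (Sum.elim c fun p => e p.1 p.2) ↔ φ.Realize (Sum.elim c fun p => e' p.1 p.2) := by
  rw [← range_uncurry_subtype] at hc
  obtain ⟨θ, hθ, hfin⟩ := exists_formula_of_forall_mem_acl hc
  let d : J × Fin k → M := fun p => p.1.1 p.2
  -- Quantifying over all solutions of `θ` removes `c`, leaving only members of `I` as parameters.
  let Φ : L.Formula ((J ⊕ (Fin m ⊕ Fin m)) × Fin k) := Formula.iAlls γ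
    ((θ.relabel (Sum.map (fun p => (Sum.inl p.1, p.2)) id)).imp
      ((φ.relabel (Sum.elim Sum.inr fun p => Sum.inl (Sum.inr (Sum.inl p.1), p.2))).iff
        (φ.relabel (Sum.elim Sum.inr fun p => Sum.inl (Sum.inr (Sum.inr p.1), p.2)))))
  let val (a b : Fin m → (Fin k → M)) : J ⊕ (Fin m ⊕ Fin m) → (Fin k → M) :=
    Sum.elim (↑) (Sum.elim a b)
  have hΦ : ∀ a b : Fin m → (Fin k → M), Φ.Realize (fun p => val a b p.1 p.2) ↔
      ∀ x : γ → M, θ.Realize (Sum.elim d x) →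
        (φ.Realize (Sum.elim x fun p => a p.1 p.2) ↔
          φ.Realize (Sum.elim x fun p => b p.1 p.2)) := by
    intro a b
    simp only [Φ, Formula.realize_iAlls, Formula.realize_imp, Formula.realize_iff,
      Formula.realize_relabel]
    refine forall_congr' fun x => ?_
    have h1 : (fun p => Sum.elim (fun p : (J ⊕ (Fin m ⊕ Fin m)) × Fin k => val a b p.1 p.2) x p) ∘
        Sum.map (fun p : J × Fin k => (Sum.inl p.1, p.2)) id = Sum.elim d x := by
      ext (p | p) <;> rfl
    have h2 : (fun p => Sum.elim (fun p : (J ⊕ (Fin m ⊕ Fin m)) × Fin k => val a b p.1 p.2) x p) ∘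
        Sum.elim Sum.inr (fun p : Fin m × Fin k => Sum.inl (Sum.inr (Sum.inl p.1), p.2)) =
        Sum.elim x fun p => a p.1 p.2 := by
      ext (p | p) <;> rfl
    have h3 : (fun p => Sum.elim (fun p : (J ⊕ (Fin m ⊕ Fin m)) × Fin k => val a b p.1 p.2) x p) ∘
        Sum.elim Sum.inr (fun p : Fin m × Fin k => Sum.inl (Sum.inr (Sum.inr p.1), p.2)) =
        Sum.elim x fun p => b p.1 p.2 := by
      ext (p | p) <;> rfl
    rw [h1, h2, h3]
  have hval : ∀ a b : Fin m → (Fin k → M), Function.Injective a → Function.Injective b →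
      (∀ i, a i ∈ I \ J) → (∀ i, b i ∈ I \ J) → (∀ i j, a i ≠ b j) →
      Function.Injective (val a b) ∧ ∀ i, val a b i ∈ I := by
    intro a b ha hb haI hbI hab
    refine ⟨Subtype.val_injective.sumElim (ha.sumElim hb hab) ?_, ?_⟩
    · rintro ⟨x, hx⟩ (i | i) h
      · exact (haI i).2 ((show x = a i from h) ▸ hx)
      · exact (hbI i).2 ((show x = b i from h) ▸ hx)
    · rintro (x | i | i)
      · exact hJ x.2
      · exact (haI i).1
      · exact (hbI i).1
  have hinf' : (((I \ J) \ Set.range e) \ Set.range e').Infinite :=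
    (hinf.sdiff (Set.finite_range e)).sdiff (Set.finite_range e')
  have := hinf'.to_subtype
  obtain ⟨h⟩ : Nonempty (ℕ × Fin m ↪ (((I \ J) \ Set.range e) \ Set.range e' : Set _)) :=
    ⟨(Encodable.encode' (ℕ × Fin m)).trans (Infinite.natEmbedding _)⟩
  let E : ℕ → Fin m → (Fin k → M) := fun j i => h (j, i)
  have hEinj : ∀ j, Function.Injective (E j) := fun j a b hab => by
    simpa using h.injective (Subtype.val_injective hab)
  have hEI : ∀ j i, E j i ∈ I \ J := fun j i => (h (j, i)).2.1.1
  have := hfin.to_subtype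
  -- Pigeonhole: a finite solution set has only finitely many subsets.
  obtain ⟨i, j, hij, hS⟩ := Finite.exists_ne_map_eq_of_infinite
    fun j : ℕ => {x : {x | θ.Realize (Sum.elim d x)} |
      φ.Realize (Sum.elim x.1 fun p => E j p.1 p.2)}
  have hEE : Φ.Realize (fun p => val (E i) (E j) p.1 p.2) :=
    (hΦ _ _).2 fun x hx => Set.ext_iff.1 hS ⟨x, hx⟩
  have hv := hval (E i) (E j) (hEinj i) (hEinj j) (hEI i) (hEI j) fun a b hab => by
    have := h.injective (Subtype.val_injective hab)
    exact hij (Prod.ext_iff.1 this).1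
  have main : ∀ a : Fin m → (Fin k → M), Function.Injective a → (∀ i, a i ∈ I \ J) →
      (∀ p q, E 0 p ≠ a q) →
      (φ.Realize (Sum.elim c fun p => E 0 p.1 p.2) ↔
        φ.Realize (Sum.elim c fun p => a p.1 p.2)) := by
    intro a ha haI hEa
    have hw := hval (E 0) a (hEinj 0) ha (hEI 0) haI hEa
    exact (hΦ _ _).1 ((hI.realize_iff hv.1 hw.1 hv.2 hw.2 Φ).1 hEE) c hθ
  rw [← main e he heI fun p q hpq => (h (0, p)).2.1.2 ⟨q, hpq.symm⟩,
    ← main e' he' heI' fun p q hpq => (h (0, p)).2.2 ⟨q, hpq.symm⟩]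

theorem realize_acl_iff (hI : L.IsIndiscernibleSet I) (hJ : J ⊆ I)
    (hinf : (I \ J).Infinite) {γ : Type*} {c : γ → M}
    (hc : ∀ i, c i ∈ L.acl (⋃ e ∈ J, Set.range e)) {m : ℕ} {e e' : Fin m → (Fin k → M)}
    (he : Function.Injective e) (he' : Function.Injective e')
    (heI : ∀ i, e i ∈ I \ J) (heI' : ∀ i, e' i ∈ I \ J) (φ : L.Formula (γ ⊕ Fin m × Fin k)) :
    φ.Realize (Sum.elim c fun p => e p.1 p.2) ↔ φ.Realize (Sum.elim c fun p => e' p.1 p.2) := by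
  classical
  obtain ⟨s, ψ, hψ⟩ := φ.exists_restrict_finset
  let g : s → s.toLeft ⊕ Fin m × Fin k := fun p => match p with
    | ⟨Sum.inl i, hi⟩ => Sum.inl ⟨i, Finset.mem_toLeft.2 hi⟩
    | ⟨Sum.inr q, _⟩ => Sum.inr q
  have key : ∀ x : Fin m × Fin k → M, (ψ.relabel g).Realize
      (Sum.elim (fun i : s.toLeft => c i) x) ↔ φ.Realize (Sum.elim c x) := by
    intro x
    rw [Formula.realize_relabel, ← hψ]
    have : Sum.elim (fun i : s.toLeft => c i) x ∘ g = fun i : s => Sum.elim c x i := by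
      ext ⟨p | p, hp⟩ <;> rfl
    rw [this]
  rw [← key, ← key]
  exact hI.realize_acl_iff_of_finite hJ hinf (fun i : s.toLeft => hc i) he he' heI heI' _

/-- If `M` is the algebraic closure of an uncountable indiscernible set, then there are only
countably many types of `n`-tuples of `M` over a countable family `g`. -/
theorem exists_countable_invariant [Countable L.Symbols] (hI : L.IsIndiscernibleSet I)
    (hunc : ¬ I.Countable) (hM : ∀ a : M, a ∈ L.acl (⋃ e ∈ I, Set.range e))
    {ι : Type*} [Countable ι] (g : ι → M) (n : ℕ) :
    ∃ inv : (Fin n → M) → ℕ, ∀ b b', inv b = inv b' →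
      ∀ φ : L.Formula (ι ⊕ Fin n), φ.Realize (Sum.elim g b) → φ.Realize (Sum.elim g b') := by
  choose F hFI hFfin hF using fun a => exists_finite_of_mem_acl_biUnion (hM a)
  let J : Set (Fin k → M) := ⋃ i, F (g i)
  have hJI : J ⊆ I := Set.iUnion_subset fun i => hFI _
  have hJc : J.Countable := Set.countable_iUnion fun i => (hFfin _).countable
  have hinf : (I \ J).Infinite := fun h =>
    hunc ((h.countable.union hJc).mono fun x hx => by by_cases hxJ : x ∈ J <;> simp [hx, hxJ])
  have : Countable J := hJc
  -- The coordinates of `J` are included because `b` is algebraic only over them together with `e`.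
  let c : (J × Fin k) ⊕ ι → M := Sum.elim (fun p => p.1.1 p.2) g
  have hc : ∀ i, c i ∈ L.acl (⋃ e ∈ J, Set.range e) := by
    rintro (p | i)
    · exact subset_acl _ (Set.mem_biUnion p.1.2 ⟨p.2, rfl⟩)
    · exact acl_mono (Set.biUnion_subset_biUnion_left (Set.subset_iUnion _ i)) (hF (g i))
  let Z := Σ m : ℕ, L.Formula ((((J × Fin k) ⊕ ι) ⊕ Fin m × Fin k) ⊕ Fin n)
  have hZ : ∀ b : Fin n → M, ∃ z : Z, ∃ e : Fin z.1 → (Fin k → M), Function.Injective e ∧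
      (∀ i, e i ∈ I \ J) ∧ z.2.Realize (Sum.elim (Sum.elim c fun p => e p.1 p.2) b) ∧
      ∀ φ : L.Formula ((((J × Fin k) ⊕ ι) ⊕ Fin z.1 × Fin k) ⊕ Fin n),
        φ.Realize (Sum.elim (Sum.elim c fun p => e p.1 p.2) b) → ∀ x : Fin n → M,
          z.2.Realize (Sum.elim (Sum.elim c fun p => e p.1 p.2) x) →
            φ.Realize (Sum.elim (Sum.elim c fun p => e p.1 p.2) x) := by
    intro b
    let G : Set (Fin k → M) := (⋃ i, F (b i)) \ J
    have hG : G.Finite := (Set.finite_iUnion fun i => hFfin (b i)).sdiff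
    have := hG.fintype
    let ε := (Fintype.equivFin G).symm
    let e : Fin (Fintype.card G) → (Fin k → M) := fun i => ε i
    have hbe : ∀ i, b i ∈ L.acl (Set.range (Sum.elim c fun p : Fin (Fintype.card G) × Fin k => e p.1 p.2)) := by
      intro i
      refine acl_mono (Set.iUnion₂_subset fun x hx => ?_) (hF (b i))
      rintro _ ⟨q, rfl⟩
      by_cases hxJ : x ∈ J
      · exact ⟨Sum.inl (Sum.inl (⟨x, hxJ⟩, q)), rfl⟩
      · have hxG : x ∈ G := ⟨Set.mem_iUnion.2 ⟨i, hx⟩, hxJ⟩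
        exact ⟨Sum.inr (ε.symm ⟨x, hxG⟩, q), by simp [e]⟩
    obtain ⟨χ, h1, h2⟩ := exists_isolating_formula_of_forall_mem_acl hbe
    refine ⟨⟨_, χ⟩, e, Subtype.val_injective.comp ε.injective, fun i => ⟨?_, (ε i).2.2⟩, h1, h2⟩
    obtain ⟨j, hj⟩ := Set.mem_iUnion.1 (ε i).2.1
    exact hFI _ hj
  choose z hz using hZ
  obtain ⟨enc, henc⟩ := exists_injective_nat Z
  refine ⟨fun b => enc (z b), fun b b' hbb φ hφ => ?_⟩
  obtain ⟨e, he, heI, -, hiso⟩ := hz b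
  have hb' := hz b'
  rw [← henc hbb] at hb'
  obtain ⟨e', he', heI', hχ', -⟩ := hb'
  let φ' : L.Formula ((((J × Fin k) ⊕ ι) ⊕ Fin (z b).1 × Fin k) ⊕ Fin n) :=
    φ.relabel (Sum.map (fun i => Sum.inl (Sum.inr i)) id)
  have hφ' : ∀ (a : Fin (z b).1 × Fin k → M) (x : Fin n → M),
      φ'.Realize (Sum.elim (Sum.elim c a) x) ↔ φ.Realize (Sum.elim g x) := by
    intro a x
    rw [Formula.realize_relabel, Sum.elim_comp_map]
    rfl
  -- That the isolating formula implies `φ'` is a statement about `c` and `e`, so it transfers to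
  -- `e'`, over which `b'` satisfies the same formula.
  have hall := (hI.realize_acl_iff hJI hinf hc he he' heI heI'
    (Formula.iAlls (Fin n) ((z b).2.imp φ'))).1 (by
      simp only [Formula.realize_iAlls, Formula.realize_imp]
      exact hiso φ' ((hφ' _ _).2 hφ))
  simp only [Formula.realize_iAlls, Formula.realize_imp] at hall
  exact (hφ' _ _).1 (hall b' hχ')

end IsIndiscernibleSet

end FirstOrder.Language

/-! ### Saturation and realization of partial types. -/

namespace FirstOrder.Language

variable {L : Language.{u, v}} {M : Type w}

/-- A formula with parameters from `A` and free variables in `β`, as a sentence in the language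
of complete types over `A`. -/
noncomputable def paramSentence (A : Set M) {β : Type*} (φ : L.Formula (A ⊕ β)) :
    L[[A]][[β]].Sentence :=
  Formula.equivSentence (BoundedFormula.constantsVarsEquiv.symm φ : L[[A]].Formula β)

theorem paramSentence_surjective (A : Set M) {β : Type*} :
    Function.Surjective (paramSentence (L := L) A (β := β)) := fun σ =>
  ⟨BoundedFormula.constantsVarsEquiv (Formula.equivSentence.symm σ), by
    simp [paramSentence]⟩

theorem paramSentence_not (A : Set M) {β : Type*} (φ : L.Formula (A ⊕ β)) :
    paramSentence A φ.not = (paramSentence A φ).not := by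
  rw [paramSentence, paramSentence, ← Formula.equivSentence_not]
  rfl

variable [L.Structure M]

theorem realize_constantsVarsEquiv_symm {A : Set M} {β : Type*} (φ : L.Formula (A ⊕ β))
    (x : β → M) :
    Formula.Realize (BoundedFormula.constantsVarsEquiv.symm φ : L[[A]].Formula β) x ↔
      φ.Realize (Sum.elim (↑) x) := by
  have := BoundedFormula.realize_constantsVarsEquiv (M := M) (n := 0)
    (φ := (BoundedFormula.constantsVarsEquiv (L := L) (γ := A) (α := β) (n := 0)).symm φ)
    (v := x) (xs := default)
  rw [(BoundedFormula.constantsVarsEquiv (L := L) (γ := A) (α := β) (n := 0)).apply_symm_apply φ]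
    at this
  exact this.symm

/-- By compactness the partial type extends to a complete one, to which saturation applies. -/
theorem IsSaturated.exists_realize [Nonempty M] (hM : L.IsSaturated M) {A : Set M}
    (hA : #A < #M) {n : ℕ} (S : Set (L.Formula (A ⊕ Fin n)))
    (hS : ∀ F : Finset (L.Formula (A ⊕ Fin n)), (F : Set _) ⊆ S →
      ∃ x : Fin n → M, ∀ φ ∈ F, φ.Realize (Sum.elim (↑) x)) :
    ∃ x : Fin n → M, ∀ φ ∈ S, φ.Realize (Sum.elim (↑) x) := by
  classical
  let T := L[[A]].completeTheory M
  have hsat : ((L[[A]].lhomWithConstants (Fin n)).onTheory T ∪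
      paramSentence A '' S).IsSatisfiable := by
    rw [Theory.isSatisfiable_iff_isFinitelySatisfiable]
    intro T₀ hT₀
    let p : L[[A]][[Fin n]].Sentence → Prop := fun σ => σ ∈ paramSentence A '' S
    have h1 : ((T₀.filter p : Finset _) : Set _) ⊆ paramSentence A '' S := by
      intro σ hσ
      exact (Finset.mem_filter.1 hσ).2
    obtain ⟨F, hF, hFT⟩ := Finset.subset_set_image_iff.1 h1
    obtain ⟨x, hx⟩ := hS F hF
    let t := T.typeOf x
    refine t.isMaximal.1.mono fun σ hσ => ?_
    rcases hT₀ hσ with h | h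
    · exact t.subset h
    · have : σ ∈ F.image (paramSentence A) := by
        rw [hFT]
        exact Finset.mem_filter.2 ⟨hσ, h⟩
      obtain ⟨φ, hφ, rfl⟩ := Finset.mem_image.1 this
      exact Theory.CompleteType.formula_mem_typeOf.2
        ((realize_constantsVarsEquiv_symm φ x).2 (hx φ hφ))
  obtain ⟨p, hp⟩ : {p : T.CompleteType (Fin n) | paramSentence A '' S ⊆ ↑p}.Nonempty := by
    rw [Set.nonempty_iff_ne_empty]
    exact fun h => (Theory.CompleteType.setOfPred_subset_eq_empty_iff _).1 h hsat
  obtain ⟨x, hx⟩ := hM A hA n p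
  refine ⟨x, fun φ hφ => ?_⟩
  have : paramSentence A φ ∈ p := hp ⟨φ, hφ, rfl⟩
  rw [← hx] at this
  exact (realize_constantsVarsEquiv_symm φ x).1 (Theory.CompleteType.formula_mem_typeOf.1 this)

/-- Realization of finitely satisfiable sets of formulas with parameters from a family. -/
theorem IsSaturated.exists_realize_of_family [Nonempty M] (hM : L.IsSaturated M) {ι : Type*}
    {d : ι → M} (hd : #(Set.range d) < #M) {n : ℕ} (S : Set (L.Formula (ι ⊕ Fin n)))
    (hS : ∀ F : Finset (L.Formula (ι ⊕ Fin n)), (F : Set _) ⊆ S →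
      ∃ x : Fin n → M, ∀ φ ∈ F, φ.Realize (Sum.elim d x)) :
    ∃ x : Fin n → M, ∀ φ ∈ S, φ.Realize (Sum.elim d x) := by
  classical
  let f : ι → Set.range d := Set.rangeFactorization d
  let r : L.Formula (ι ⊕ Fin n) → L.Formula (Set.range d ⊕ Fin n) :=
    fun φ => φ.relabel (Sum.map f id)
  have hr : ∀ (φ : L.Formula (ι ⊕ Fin n)) (x : Fin n → M),
      (r φ).Realize (Sum.elim (↑) x) ↔ φ.Realize (Sum.elim d x) := by
    intro φ x
    rw [Formula.realize_relabel, Sum.elim_comp_map]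
    rfl
  obtain ⟨x, hx⟩ := hM.exists_realize hd (r '' S) (by
    intro F hF
    obtain ⟨F', hF', rfl⟩ := Finset.subset_set_image_iff.1 hF
    obtain ⟨x, hx⟩ := hS F' hF'
    refine ⟨x, fun φ hφ => ?_⟩
    obtain ⟨ψ, hψ, rfl⟩ := Finset.mem_image.1 hφ
    exact (hr ψ x).2 (hx ψ hψ))
  exact ⟨x, fun φ hφ => (hr φ x).1 (hx _ ⟨φ, hφ, rfl⟩)⟩

variable {N : Type w'} [L.Structure N]

/-- If `d` and `s` have the same type and a set of formulas over `s` is finitely satisfiable, then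
the corresponding set over `d` is realized in the saturated structure `M`. -/
theorem IsSaturated.exists_realize_of_forall_iff [Nonempty M] (hM : L.IsSaturated M) {ι : Type*}
    {d : ι → M} (hd : #(Set.range d) < #M) {s : ι → N}
    (hds : ∀ φ : L.Formula ι, φ.Realize s ↔ φ.Realize d) {n : ℕ}
    (S : Set (L.Formula (ι ⊕ Fin n)))
    (hS : ∀ F : Finset (L.Formula (ι ⊕ Fin n)), (F : Set _) ⊆ S →
      ∃ x : Fin n → N, ∀ φ ∈ F, φ.Realize (Sum.elim s x)) :
    ∃ x : Fin n → M, ∀ φ ∈ S, φ.Realize (Sum.elim d x) := by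
  refine hM.exists_realize_of_family hd S fun F hF => ?_
  obtain ⟨x, hx⟩ := hS F hF
  have := (hds (Formula.iExs (Fin n) (Formula.iInf fun φ : F => φ.1))).1 (by
    rw [Formula.realize_iExs]
    exact ⟨x, by
      rw [Formula.realize_iInf]
      exact fun φ => hx φ φ.2⟩)
  rw [Formula.realize_iExs] at this
  obtain ⟨y, hy⟩ := this
  rw [Formula.realize_iInf] at hy
  exact ⟨y, fun φ hφ => hy ⟨φ, hφ⟩⟩

/-- The copy is built one element at a time: each step realizes a type over a finite set, which is
smaller than `M`. -/
theorem IsSaturated.exists_forall_realize_iff [Nonempty M] (hM : L.IsSaturated M)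
    (hinf : ℵ₀ ≤ #M) (hMN : ∀ φ : L.Sentence, N ⊨ φ ↔ M ⊨ φ) (s : ℕ → N) :
    ∃ d : ℕ → M, ∀ φ : L.Formula ℕ, φ.Realize s ↔ φ.Realize d := by
  classical
  let P (n : ℕ) (d : Fin n → M) : Prop :=
    ∀ φ : L.Formula (Fin n), φ.Realize (fun i => s i) ↔ φ.Realize d
  have step : ∀ n (d : Fin n → M), P n d → ∃ b : M, P (n + 1) (Fin.snoc d b) := by
    intro n d hd
    have hfin : #(Set.range d) < #M := (Cardinal.lt_aleph0_of_finite _).trans_le hinf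
    obtain ⟨x, hx⟩ := hM.exists_realize_of_forall_iff hfin hd
      {φ : L.Formula (Fin n ⊕ Fin 1) | φ.Realize (Sum.elim (fun i : Fin n => s i) fun _ => s n)}
      fun F hF => ⟨_, fun φ hφ => hF hφ⟩
    refine ⟨x 0, ?_⟩
    have himp : ∀ φ : L.Formula (Fin (n + 1)), φ.Realize (fun i => s i) →
        φ.Realize (Fin.snoc d (x 0) : Fin (n + 1) → M) := by
      intro φ hφ
      let g : Fin (n + 1) → Fin n ⊕ Fin 1 := Fin.snoc (fun i => Sum.inl i) (Sum.inr 0)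
      have := hx (φ.relabel g) (by
        rw [Set.mem_ofPred_eq, Formula.realize_relabel]
        convert hφ using 1
        ext i
        refine Fin.lastCases ?_ (fun i => ?_) i <;> simp [g])
      rw [Formula.realize_relabel] at this
      convert this using 1
      ext i
      refine Fin.lastCases ?_ (fun i => ?_) i <;> simp [g]
    refine fun φ => ⟨himp φ, fun h => ?_⟩
    by_contra hn
    exact himp φ.not hn h
  choose! f hf using step
  let D : (n : ℕ) → Fin n → M := fun n =>
    Nat.rec (motive := fun n => Fin n → M) Fin.elim0 (fun n d => Fin.snoc d (f n d)) n
  have hD : ∀ n, P n (D n) := by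
    intro n
    induction n with
    | zero =>
      intro φ
      have h1 := hMN (φ.relabel (Fin.elim0 : Fin 0 → Empty))
      rw [Sentence.Realize, Sentence.Realize, Formula.realize_relabel,
        Formula.realize_relabel] at h1
      convert h1 using 2
    | succ n ih => exact hf n _ ih
  let d : ℕ → M := fun i => D (i + 1) (Fin.last i)
  have hDd : ∀ n (i : Fin n), D n i = d i := by
    intro n
    induction n with
    | zero => exact fun i => i.elim0
    | succ n ih =>
      intro i
      refine Fin.lastCases rfl (fun i => ?_) i
      have : D (n + 1) i.castSucc = D n i := Fin.snoc_castSucc (α := fun _ => M) _ _ _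
      rw [this, ih]
      rfl
  refine ⟨d, fun φ => ?_⟩
  -- A strict bound on the variables of `φ`, so that they all lie in `Fin n`.
  let n := φ.freeVarFinset.sup id + 1
  let g : φ.freeVarFinset → Fin n := fun i =>
    ⟨i, Nat.lt_succ_of_le (Finset.le_sup (f := id) i.2)⟩
  have hs : Formula.Realize (φ.restrictFreeVar g) (fun i => s i) ↔ φ.Realize s :=
    BoundedFormula.realize_restrictFreeVar s fun _ => rfl
  have hd : Formula.Realize (φ.restrictFreeVar g) (D n) ↔ φ.Realize d :=
    BoundedFormula.realize_restrictFreeVar d fun i => hDd n (g i)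
  rw [← hs, ← hd]
  exact hD n _

end FirstOrder.Language

/-! ### Transferring types from `N` to `M`. -/

namespace FirstOrder.Language

variable {L : Language.{u, v}} {M : Type w} [L.Structure M] {N : Type w'} [L.Structure N]

/-- The sentence asserting that finitely many formulas have a common solution. -/
noncomputable def commonSolutionSentence {β : Type*} [Finite β]
    (F : Finset (L.Formula β)) : L.Sentence :=
  Formula.iExs β ((Formula.iInf fun φ : F => φ.1).relabel (Sum.inr : β → Empty ⊕ β))

theorem realize_commonSolutionSentence {β : Type*} [Finite β] (F : Finset (L.Formula β)) :
    N ⊨ commonSolutionSentence F ↔ ∃ x : β → N, ∀ φ ∈ F, φ.Realize x := by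
  simp only [commonSolutionSentence, Sentence.Realize, Formula.realize_iExs,
    Formula.realize_relabel, Formula.realize_iInf, Sum.elim_comp_inr, Subtype.forall]

theorem exists_realize_of_finset_subset_completeType [Nonempty N] {β : Type*} [Finite β]
    (p : (L.completeTheory N).CompleteType β) (F : Finset (L.Formula β))
    (hF : ∀ φ ∈ F, Formula.equivSentence φ ∈ p) : ∃ x : β → N, ∀ φ ∈ F, φ.Realize x := by
  obtain ⟨K, x, rfl⟩ := Theory.exists_modelType_is_realized_in _ p
  rw [← realize_commonSolutionSentence]
  by_contra hn
  have hK : K ⊨ (commonSolutionSentence F).not := (L.completeTheory N).realize_sentence_of_mem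
    (mem_completeTheory.2 ((Sentence.realize_not N).2 hn))
  exact (Sentence.realize_not K).1 hK ((realize_commonSolutionSentence F).2
    ⟨x, fun φ hφ => Theory.CompleteType.formula_mem_typeOf.1 (hF φ hφ)⟩)

theorem countable_typesOver_of_countable_invariant [Nonempty M] [Nonempty N]
    (hM : L.IsSaturated M) (hcard : ℵ₀ < #M)
    (hMN : ∀ φ : L.Sentence, N ⊨ φ ↔ M ⊨ φ) {A : Set N} (hA : A.Countable) {n : ℕ}
    (hinv : ∀ g : A → M, ∃ inv : (Fin n → M) → ℕ, ∀ b b', inv b = inv b' →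
      ∀ φ : L.Formula (A ⊕ Fin n), φ.Realize (Sum.elim g b) → φ.Realize (Sum.elim g b')) :
    Countable (L.TypesOver A n) := by
  classical
  have : Countable A := hA
  obtain ⟨s, hs⟩ := Set.countable_iff_exists_subset_range.1 hA
  obtain ⟨d, hd⟩ := hM.exists_forall_realize_iff hcard.le hMN s
  choose idx hidx using fun a : A => hs a.2
  let g : A → M := fun a => d (idx a)
  have hg : ∀ φ : L.Formula A, φ.Realize ((↑) : A → N) ↔ φ.Realize g := by
    intro φ
    have := hd (φ.relabel idx)
    rw [Formula.realize_relabel, Formula.realize_relabel,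
      show s ∘ idx = ((↑) : A → N) from funext hidx] at this
    exact this
  have hgcard : #(Set.range g) < #M :=
    (Cardinal.le_aleph0_iff_set_countable.2 (Set.countable_range g)).trans_lt hcard
  have hreal : ∀ p : L.TypesOver A n, ∃ b : Fin n → M,
      ∀ φ ∈ {φ : L.Formula (A ⊕ Fin n) | paramSentence A φ ∈ p},
        φ.Realize (Sum.elim g b) := by
    intro p
    refine hM.exists_realize_of_forall_iff hgcard hg _ fun F hF => ?_
    obtain ⟨x, hx⟩ := exists_realize_of_finset_subset_completeType p
      (F.image fun φ => (BoundedFormula.constantsVarsEquiv.symm φ : L[[A]].Formula (Fin n))) (by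
        intro ψ hψ
        obtain ⟨φ, hφ, rfl⟩ := Finset.mem_image.1 hψ
        exact hF hφ)
    exact ⟨x, fun φ hφ =>
      (realize_constantsVarsEquiv_symm φ x).1 (hx _ (Finset.mem_image_of_mem _ hφ))⟩
  choose b hb using hreal
  obtain ⟨inv, hinv⟩ := hinv g
  have hsub : ∀ p q : L.TypesOver A n, inv (b p) = inv (b q) → ∀ σ ∈ p, σ ∈ q := by
    intro p q hpq σ hσ
    obtain ⟨φ, rfl⟩ := paramSentence_surjective A σ
    by_contra hn
    -- Completeness of `q` puts the negation in `q`, so one inclusion yields a contradiction and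
    -- symmetry gives the other.
    rw [← Theory.CompleteType.not_mem_iff, ← paramSentence_not] at hn
    exact (Formula.realize_not.1 (hb q _ hn)) (hinv _ _ hpq φ (hb p φ hσ))
  exact Function.Injective.countable (f := fun p => inv (b p)) fun p q hpq =>
    SetLike.ext fun σ => ⟨hsub p q hpq σ, hsub q p hpq.symm σ⟩

end FirstOrder.Language

theorem proposition2p4 (L : FirstOrder.Language.{u, v}) [Countable L.Symbols] (T : L.Theory)
    (hT : T.IsComplete)
    (hI : FirstOrder.Language.Theory.IsAlmostIndiscernible.{u, v, w} T) :
    FirstOrder.Language.Theory.IsOmegaStable.{u, v, w'} T := by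
  obtain ⟨M, hcard, hsat, k, I, hind, hM⟩ := hI
  intro N A hA n
  have hlt : ℵ₀ < #M := hcard ▸ Cardinal.aleph0_lt_aleph_one
  have hunc : ¬ I.Countable := by
    intro hc
    have h1 : (⋃ e ∈ I, Set.range e).Countable := hc.biUnion fun e _ => Set.countable_range e
    have h2 : (Set.univ : Set M).Countable :=
      (FirstOrder.Language.countable_acl (L := L) h1).mono fun a _ => hM a
    exact hlt.not_ge (Cardinal.mk_le_aleph0_iff.2 (Set.countable_univ_iff.1 h2))
  have : Countable A := hA
  exact FirstOrder.Language.countable_typesOver_of_countable_invariant hsat hlt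
    (fun φ => (hT.realize_sentence_iff φ N).trans (hT.realize_sentence_iff φ M).symm) hA
    fun g => hind.exists_countable_invariant hunc hM g n
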